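/- Fix a function-free relational signature with a set $\mathcal C$ of constants. A fact is an atom $R(\vec c)$ over constants, an instance (database) is a set of facts, and $\mathrm{consts}(I)$ is the set of constants occurring in $I$. A TGD is a sentence $\tau=\forall\vec x\,[\beta(\vec x)\to\exists\vec y\,\eta(\vec x,\vec y)]$ with $\beta,\eta$ finite conjunctions of constant-free atoms and $\mathrm{vars}(\beta)=\vec x$; it is full if $\vec y$ is empty, and guarded (a GTGD) if some atom of $\beta$ contains all variables of $\beta$. A UBCQ over $\mathcal D$ is a finite disjunction of Boolean conjunctive queries whose constants all occur in $\mathcal D$. Let $\mathcal D$ be a database such that infinitely many constants do not occur in $\mathcal D$ (for example, $\mathcal D$ finite and $\mathcal C$ infinite), and let $\Sigma$ be a set of GTGDs. **Chase proofs.** An oblivious chase step on an instance $I$ takes $\tau\in\Sigma$ and a map $h$ on $\vec x$ with $h(\beta)\subseteq I$ (a trigger), extends $h$ to $h'$ by sending the variables $\vec y$ to pairwise distinct constants not in $\mathrm{consts}(I)$, and replaces $I$ by $I\cup h'(\eta)$. In a restricted chase step, $h$ must moreover be active: no extension $h''$ of $h$ to $\vec y$ satisfies $h''(\eta)\subseteq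 I$. A (restricted or oblivious) chase proof of $Q$ from $\mathcal D$ and $\Sigma$ is a finite sequence $\mathcal D=I_0,\dots,I_n$ of such steps with $I_n\models Q$. **Trees.** Consider finite rooted trees each of whose nodes $v$ carries a set of facts $F_v$ (its bag); the instance of such a tree is the union of its bags. A fact $G$ guards a fact $F$ if every constant of $F$ occurs in $G$. An (oblivious) chase step triggered in a node $v$ takes $\tau\in\Sigma$ and a trigger $h$ with $h(\beta)\subseteq F_v$, and chooses $h'$ as above, with constants for $\vec y$ not occurring in the instance of the tree. If $\tau$ is full, the facts $h'(\eta)$ are added to $F_v$, and we put $w=v$; otherwise a new child $w$ of $v$ with bag $h'(\eta)$ is created. Then facts are propagated to certain target nodes: every fact of the new instance is added to each target node whose bag contains a fact guarding it. * A *tree-like chase sequence* from $\mathcal D$ and $\Sigma$ is a finite sequence of trees $T_0,\dots,T_n$, where $T_0$ is a single root with bag $\mathcal D$ and each $T_{i+1}$ arises from $T_i$ by such a step in which all nodes are targets. * A *one-pass chase sequence* from $\mathcal D$ and $\Sigma$ is a sequence of the same form in which the targets of each step are $w$ and its ancestors, and such that, for every node $v$ present in some $T_i$, if for some $j\ge i$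 the step from $T_j$ to $T_{j+1}$ is triggered in a node outside the subtree of $v$, then for all $k$ with $j\le k<n$ the step from $T_k$ to $T_{k+1}$ neither creates a node in the subtree of $v$ nor changes a bag in it. A *one-pass chase proof* of $Q$ is a one-pass chase sequence $T_0,\dots,T_n$ such that the instance of $T_n$ satisfies $Q$. **Theorem.** 1. For every UBCQ $Q$ over $\mathcal D$, the following are equivalent: $Q$ has an oblivious chase proof from $\mathcal D$ and $\Sigma$; $Q$ has a restricted chase proof from $\mathcal D$ and $\Sigma$; $Q$ has a one-pass chase proof from $\mathcal D$ and $\Sigma$. 2. For every tree-like chase sequence $T_0,\dots,T_n$ from $\mathcal D$ and $\Sigma$ there are a one-pass chase sequence $T'_0,\dots,T'_m$ from $\mathcal D$ and $\Sigma$ and a homomorphism $h$ from the instance of $T_n$ to the instance of $T'_m$ with $h(c)=c$ for all $c\in\mathrm{consts}(\mathcal D)$. -/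

import Mathlib

/-! ### Relational model, queries and dependencies -/

/-- A relational schema: relation symbols with their arities. -/
structure Schema where
  Rel : Type*
  arity : Rel → ℕ

/-- An atom `R(t₁, …, tₙ)` whose arguments are taken from `T`. -/
structure Atom (S : Schema) (T : Type*) where
  rel : S.Rel
  args : Fin (S.arity rel) → T

/-- The set of arguments occurring in an atom. -/
def Atom.terms {S : Schema} {T : Type*} (A : Atom S T) : Set T := Set.range A.args

/-- Apply a map to all arguments of an atom. -/
def Atom.map {S : Schema} {T U : Type*} (f : T → U) (A : Atom S T) : Atom S U :=
  ⟨A.rel, fun i => f (A.args i)⟩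

/-- Facts are atoms over constants, and instances (databases) are sets of facts. -/
abbrev Instance (S : Schema) (C : Type*) := Set (Atom S C)

/-- The constants (or variables) occurring in a set of atoms. -/
def consts {S : Schema} {C : Type*} (I : Set (Atom S C)) : Set C := {c | ∃ F ∈ I, c ∈ F.terms}

/-- A tuple-generating dependency `body → ∃ y, head`: body and head are finite sets of
constant-free atoms. The existential variables are those of the head that are not in the body. -/
structure TGD (S : Schema) (V : Type*) where
  body : Finset (Atom S V)
  head : Finset (Atom S V)

namespace TGD

variable {S : Schema} {V : Type*}

def bodyVars (τ : TGD S V) : Set V := consts (τ.body : Set (Atom S V))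

def existVars (τ : TGD S V) : Set V := consts (τ.head : Set (Atom S V)) \ τ.bodyVars

def IsFull (τ : TGD S V) : Prop := τ.existVars = ∅

/-- Some body atom, the guard, contains all variables of the body. -/
def IsGuarded (τ : TGD S V) : Prop := ∃ G ∈ τ.body, τ.bodyVars ⊆ G.terms

/-- The body of `τ` under the valuation `g`. -/
def bodyImage {C : Type*} (τ : TGD S V) (g : V → C) : Instance S C :=
  Atom.map g '' (τ.body : Set (Atom S V))

/-- The head of `τ` under the valuation `g`. -/
def headImage {C : Type*} (τ : TGD S V) (g : V → C) : Instance S C :=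
  Atom.map g '' (τ.head : Set (Atom S V))

end TGD

/-- A Boolean conjunctive query: a finite set of atoms over variables and constants, all
variables being existentially quantified. -/
abbrev BCQ (S : Schema) (V C : Type*) := Finset (Atom S (V ⊕ C))

/-- A union of Boolean conjunctive queries. -/
abbrev UBCQ (S : Schema) (V C : Type*) := Finset (BCQ S V C)

/-- `I ⊨ q`. -/
def BCQ.Holds {S : Schema} {V C : Type*} (q : BCQ S V C) (I : Instance S C) : Prop :=
  ∃ g : V → C, ∀ A ∈ q, A.map (Sum.elim g id) ∈ I

/-- `I ⊨ Q`. -/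
def UBCQ.Holds {S : Schema} {V C : Type*} (Q : UBCQ S V C) (I : Instance S C) : Prop :=
  ∃ q ∈ Q, BCQ.Holds q I

/-- `Q` is a query over `D`: all its constants occur in `D`. -/
def UBCQ.Over {S : Schema} {V C : Type*} (Q : UBCQ S V C) (D : Instance S C) : Prop :=
  ∀ q ∈ Q, ∀ A ∈ q, ∀ c : C, Sum.inr c ∈ A.terms → c ∈ consts D

/-- `h` is a homomorphism from `I` to `J`. -/
def IsInstanceHom {S : Schema} {C : Type*} (h : C → C) (I J : Instance S C) : Prop :=
  ∀ F ∈ I, F.map h ∈ J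

/-! ### The chase -/

section Chase

variable {S : Schema} {V C : Type*}

/-- `g` sends the existential variables of `τ` to pairwise distinct constants not occurring
in `I`. -/
def FreshFor (τ : TGD S V) (g : V → C) (I : Instance S C) : Prop :=
  Set.InjOn g τ.existVars ∧ ∀ y ∈ τ.existVars, g y ∉ consts I

/-- The restriction of `g` to the body variables is an active trigger for `τ` in `I`. -/
def IsActiveTrigger (τ : TGD S V) (g : V → C) (I : Instance S C) : Prop :=
  τ.bodyImage g ⊆ I ∧ ¬ ∃ g' : V → C, Set.EqOn g' g τ.bodyVars ∧ τ.headImage g' ⊆ I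

/-- An oblivious chase step. The valuation `g` is the trigger on the body variables, together
with its extension to the existential variables. -/
def ObliviousStep (Γ : Set (TGD S V)) (I J : Instance S C) : Prop :=
  ∃ τ ∈ Γ, ∃ g : V → C, τ.bodyImage g ⊆ I ∧ FreshFor τ g I ∧ J = I ∪ τ.headImage g

/-- A restricted chase step: the trigger has to be active. -/
def RestrictedStep (Γ : Set (TGD S V)) (I J : Instance S C) : Prop :=
  ∃ τ ∈ Γ, ∃ g : V → C, IsActiveTrigger τ g I ∧ FreshFor τ g I ∧ J = I ∪ τ.headImage g

/-- `I 0, …, I n` is a chase sequence for `D` with the given kind of steps. -/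
def IsChaseSeq (step : Instance S C → Instance S C → Prop) (D : Instance S C) (n : ℕ)
    (I : ℕ → Instance S C) : Prop :=
  I 0 = D ∧ ∀ i < n, step (I i) (I (i + 1))

/-- There is an oblivious chase proof of `Q` from `D` and `Γ`. -/
def HasObliviousChaseProof (D : Instance S C) (Γ : Set (TGD S V)) (Q : UBCQ S V C) : Prop :=
  ∃ (n : ℕ) (I : ℕ → Instance S C), IsChaseSeq (ObliviousStep Γ) D n I ∧ Q.Holds (I n)

/-- There is a restricted chase proof of `Q` from `D` and `Γ`. -/
def HasRestrictedChaseProof (D : Instance S C) (Γ : Set (TGD S V)) (Q : UBCQ S V C) : Prop :=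
  ∃ (n : ℕ) (I : ℕ → Instance S C), IsChaseSeq (RestrictedStep Γ) D n I ∧ Q.Holds (I n)

end Chase

/-! ### Tree-like and one-pass chase sequences -/

/-- Tree nodes are addresses: the root is `[]`, the children of `v` are the lists `k :: v`.
Thus `u <:+ v` says that `u` is a non-strict ancestor of `v`, i.e. that `v` lies in the subtree
of `u`. -/
abbrev Node := List ℕ

/-- A tree whose nodes carry bags of facts. -/
structure BagTree (S : Schema) (C : Type*) where
  nodes : Set Node
  bag : Node → Set (Atom S C)

namespace BagTree

variable {S : Schema} {C : Type*}

/-- The instance decomposed by the tree: the union of its bags. -/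
def inst (t : BagTree S C) : Instance S C := {F | ∃ v ∈ t.nodes, F ∈ t.bag v}

/-- The tree with a single root node, associated with `D`. -/
def single (D : Instance S C) : BagTree S C where
  nodes := {[]}
  bag v := {F | v = [] ∧ F ∈ D}

/-- The bag of `u` after the new facts `N` have been put into the bag of `w`, and before
propagation. -/
def putBag (t : BagTree S C) (w : Node) (N : Set (Atom S C)) (u : Node) : Set (Atom S C) :=
  {F | F ∈ t.bag u ∨ (u = w ∧ F ∈ N)}

/-- Put the facts `N` into node `w` (which is created if it was not present), then propagate
every fact of the resulting instance to all those nodes of `P` that contain a fact guarding it. -/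
def fire (t : BagTree S C) (w : Node) (N : Set (Atom S C)) (P : Set Node) : BagTree S C where
  nodes := insert w t.nodes
  bag u := t.putBag w N u ∪
    {F | u ∈ P ∧ F ∈ t.inst ∪ N ∧ ∃ G ∈ t.putBag w N u, F.terms ⊆ G.terms}

/-- The step from `t` to `t'` modifies the subtree of `v`: it creates a node in it or changes
the bag of one of its nodes. -/
def Modifies (t t' : BagTree S C) (v : Node) : Prop :=
  ∃ w, v <:+ w ∧ (w ∈ t'.nodes \ t.nodes ∨ t'.bag w ≠ t.bag w)

end BagTree

section TreeLike

variable {S : Schema} {V C : Type*}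

/-- The node that receives the new facts when `τ` fires in `v`: the node `v` itself for a full
rule, and a new child of `v` for a non-full rule. -/
def IsReceiver (τ : TGD S V) (t : BagTree S C) (v w : Node) : Prop :=
  (τ.IsFull ∧ w = v) ∨ (¬ τ.IsFull ∧ w ∉ t.nodes ∧ ∃ k : ℕ, w = k :: v)

/-- A chase step triggered in node `v`; `targets w` are the nodes to which facts are propagated
if `w` is the node that receives the new facts. -/
def TreeStep (targets : Node → Set Node) (Γ : Set (TGD S V)) (v : Node)
    (t t' : BagTree S C) : Prop :=
  v ∈ t.nodes ∧ ∃ τ ∈ Γ, ∃ g : V → C, τ.bodyImage g ⊆ t.bag v ∧ FreshFor τ g t.inst ∧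
    ∃ w, IsReceiver τ t v w ∧ t' = t.fire w (τ.headImage g) (targets w)

/-- `T 0, …, T n` is a sequence of chase steps on trees starting from `D`, where the step from
`T i` to `T (i + 1)` is triggered in node `p i`. -/
def IsTreeSeq (targets : Node → Set Node) (D : Instance S C) (Γ : Set (TGD S V)) (n : ℕ)
    (T : ℕ → BagTree S C) (p : ℕ → Node) : Prop :=
  T 0 = BagTree.single D ∧ ∀ i < n, TreeStep targets Γ (p i) (T i) (T (i + 1))

/-- The tree-like chase: facts are propagated to all nodes. -/
def IsTreeLikeChaseSeq (D : Instance S C) (Γ : Set (TGD S V)) (n : ℕ)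
    (T : ℕ → BagTree S C) (p : ℕ → Node) : Prop :=
  IsTreeSeq (fun _ => Set.univ) D Γ n T p

/-- The one-pass chase: facts are propagated to the receiving node and its ancestors, and once a
step is triggered outside the subtree of a present node `v`, neither this step nor any later one
modifies the subtree of `v`. -/
def IsOnePassChaseSeq (D : Instance S C) (Γ : Set (TGD S V)) (n : ℕ)
    (T : ℕ → BagTree S C) (p : ℕ → Node) : Prop :=
  IsTreeSeq (fun w => {u | u <:+ w}) D Γ n T p ∧
    ∀ v i j k, i ≤ j → j ≤ k → k < n → v ∈ (T i).nodes → ¬ v <:+ p j →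
      ¬ BagTree.Modifies (T k) (T (k + 1)) v

/-- There is a one-pass chase proof of `Q` from `D` and `Γ`. -/
def HasOnePassChaseProof (D : Instance S C) (Γ : Set (TGD S V)) (Q : UBCQ S V C) : Prop :=
  ∃ (n : ℕ) (T : ℕ → BagTree S C) (p : ℕ → Node),
    IsOnePassChaseSeq D Γ n T p ∧ Q.Holds (T n).inst

end TreeLike

/-! The substantial direction leads from oblivious to one-pass chase proofs. The instances of any
tree sequence form an oblivious chase sequence, restricted steps are oblivious, and queries over `D`
survive homomorphisms that fix `consts D`.

Steps of a given chase are not reordered. Instead an intermediate class of instances is used: the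
unfoldings, trees whose bags are saturated under `Derives` as soon as they are created. `Derives`
anticipates whatever a bag could ever receive back from its descendants, so later work below a child
brings its parent nothing new, and children may grow in any order. Guardedness makes this class
closed under satisfying triggers (`Unfolding.exists_extension`): all facts of a trigger are
available in the part that contains the image of the guard. Hence every oblivious chase maps into an
unfolding (`IsChaseSeq.exists_hom`).

A finite part of an unfolding is then realized depth first. Before a child is created, the facts
that it relies on are derived in the parent. Each such derivation is a finite recursion through
auxiliary children, which are abandoned once their result has been propagated back
(`Derives.realizable`, `Unfolding.exists_onePassReach`). As `D` may be infinite, saturated bags may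
be too, and compactness of `Derives` reduces them to finitely many facts. -/

/-! ### Atoms, constants and valuations of rules -/

namespace Atom

variable {S : Schema} {T U W : Type*}

theorem map_map (f : T → U) (g : U → W) (A : Atom S T) : (A.map f).map g = A.map (g ∘ f) := rfl

theorem map_congr {f g : T → U} {A : Atom S T} (h : Set.EqOn f g A.terms) : A.map f = A.map g := by
  unfold map
  congr 1
  funext i
  exact h ⟨i, rfl⟩

theorem map_eq_self {f : T → T} {A : Atom S T} (h : Set.EqOn f id A.terms) : A.map f = A :=
  map_congr h

theorem terms_map (f : T → U) (A : Atom S T) : (A.map f).terms = f '' A.terms :=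
  Set.range_comp f A.args

theorem finite_terms (A : Atom S T) : A.terms.Finite := Set.finite_range _

end Atom

section Consts

variable {S : Schema} {T U : Type*}

theorem terms_subset_consts {I : Set (Atom S T)} {F : Atom S T} (h : F ∈ I) :
    F.terms ⊆ consts I := fun _ hc => ⟨F, h, hc⟩

theorem consts_mono {I J : Set (Atom S T)} (h : I ⊆ J) : consts I ⊆ consts J :=
  fun _ ⟨F, hF, hc⟩ => ⟨F, h hF, hc⟩

theorem consts_union (I J : Set (Atom S T)) : consts (I ∪ J) = consts I ∪ consts J := by
  ext c
  constructor
  · rintro ⟨F, hF | hF, hc⟩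
    exacts [.inl ⟨F, hF, hc⟩, .inr ⟨F, hF, hc⟩]
  · rintro (⟨F, hF, hc⟩ | ⟨F, hF, hc⟩)
    exacts [⟨F, .inl hF, hc⟩, ⟨F, .inr hF, hc⟩]

theorem consts_image (f : T → U) (I : Set (Atom S T)) :
    consts (Atom.map f '' I) = f '' consts I := by
  ext c
  constructor
  · rintro ⟨_, ⟨F, hF, rfl⟩, hc⟩
    rw [Atom.terms_map] at hc
    obtain ⟨d, hd, rfl⟩ := hc
    exact ⟨d, ⟨F, hF, hd⟩, rfl⟩
  · rintro ⟨d, ⟨F, hF, hd⟩, rfl⟩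
    exact ⟨_, ⟨F, hF, rfl⟩, by rw [Atom.terms_map]; exact ⟨d, hd, rfl⟩⟩

theorem finite_consts {I : Set (Atom S T)} (h : I.Finite) : (consts I).Finite := by
  have : consts I = ⋃ F ∈ I, F.terms := by
    ext c
    simp [consts]
  rw [this]
  exact h.biUnion fun F _ => F.finite_terms

theorem infinite_compl_consts_union {I J : Set (Atom S T)} (hI : (consts I)ᶜ.Infinite)
    (hJ : J.Finite) : (consts (I ∪ J))ᶜ.Infinite := by
  rw [consts_union, Set.compl_union, ← Set.sdiff_eq]
  exact hI.sdiff (finite_consts hJ)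

end Consts

namespace TGD

variable {S : Schema} {V C : Type*} {τ : TGD S V} {g g' : V → C}

theorem finite_existVars (τ : TGD S V) : τ.existVars.Finite :=
  (finite_consts τ.head.finite_toSet).subset Set.sdiff_subset

theorem finite_headImage (τ : TGD S V) (g : V → C) : (τ.headImage g).Finite :=
  τ.head.finite_toSet.image _

theorem finite_bodyImage (τ : TGD S V) (g : V → C) : (τ.bodyImage g).Finite :=
  τ.body.finite_toSet.image _

theorem consts_bodyImage (τ : TGD S V) (g : V → C) : consts (τ.bodyImage g) = g '' τ.bodyVars :=
  consts_image _ _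

theorem consts_head_subset (τ : TGD S V) :
    consts (τ.head : Set (Atom S V)) ⊆ τ.bodyVars ∪ τ.existVars := fun x hx => by
  by_cases h : x ∈ τ.bodyVars
  exacts [.inl h, .inr ⟨hx, h⟩]

theorem consts_headImage_subset (τ : TGD S V) (g : V → C) :
    consts (τ.headImage g) ⊆ g '' τ.bodyVars ∪ g '' τ.existVars := by
  rw [headImage, consts_image, ← Set.image_union]
  exact Set.image_mono τ.consts_head_subset

theorem mem_consts_headImage {y : V} (g : V → C) (hy : y ∈ τ.existVars) :
    g y ∈ consts (τ.headImage g) := by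
  rw [headImage, consts_image]
  exact ⟨y, hy.1, rfl⟩

theorem bodyImage_congr (h : Set.EqOn g' g τ.bodyVars) : τ.bodyImage g' = τ.bodyImage g :=
  Set.image_congr fun _ hA => Atom.map_congr (h.mono (terms_subset_consts hA))

theorem image_bodyImage (τ : TGD S V) (g : V → C) (h : C → C) :
    Atom.map h '' τ.bodyImage g = τ.bodyImage (h ∘ g) := by
  simp only [bodyImage, Set.image_image]
  rfl

theorem image_headImage {h : C → C} (H : Set.EqOn (h ∘ g) g' (τ.bodyVars ∪ τ.existVars)) :
    Atom.map h '' τ.headImage g = τ.headImage g' := by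
  simp only [headImage, Set.image_image]
  refine Set.image_congr fun A hA => ?_
  rw [Atom.map_map]
  exact Atom.map_congr (H.mono ((terms_subset_consts hA).trans τ.consts_head_subset))

theorem IsGuarded.exists_guard (h : τ.IsGuarded) (g : V → C) :
    ∃ G ∈ τ.bodyImage g, g '' τ.bodyVars ⊆ G.terms := by
  obtain ⟨G, hG, hb⟩ := h
  exact ⟨_, ⟨G, hG, rfl⟩, by rw [Atom.terms_map]; exact Set.image_mono hb⟩

theorem IsFull.freshFor (h : τ.IsFull) (g : V → C) (I : Instance S C) : FreshFor τ g I := by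
  rw [IsFull] at h
  simp [FreshFor, h]

theorem exists_freshFor (τ : TGD S V) (g : V → C) {I : Instance S C}
    (hI : (consts I)ᶜ.Infinite) :
    ∃ g' : V → C, Set.EqOn g' g τ.bodyVars ∧ FreshFor τ g' I := by
  classical
  have : Nonempty C := hI.nonempty.to_type
  obtain ⟨f, hf, hinj⟩ := τ.finite_existVars.exists_injOn_of_encard_le (t := (consts I)ᶜ)
    (by rw [hI.encard_eq]; exact le_top)
  have key : Set.EqOn (fun x => if x ∈ τ.existVars then f x else g x) f τ.existVars :=
    fun y hy => if_pos hy
  refine ⟨_, fun x hx => if_neg fun h => h.2 hx, hinj.congr key.symm, fun y hy => ?_⟩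
  rw [key hy]
  exact hf hy

end TGD

section Extension

variable {S : Schema} {V C : Type*}

theorem FreshFor.mono {τ : TGD S V} {g : V → C} {I J : Instance S C} (h : FreshFor τ g I)
    (hJ : J ⊆ I) : FreshFor τ g J := ⟨h.1, fun y hy hc => h.2 y hy (consts_mono hJ hc)⟩

/-- A map on the constants of `I` extends to the constants introduced by a chase step. -/
theorem FreshFor.exists_extension {τ : TGD S V} {g g' : V → C} {I : Instance S C}
    (hf : FreshFor τ g I) (hb : g '' τ.bodyVars ⊆ consts I) {h : C → C}
    (hg' : Set.EqOn g' (h ∘ g) τ.bodyVars) :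
    ∃ h' : C → C, Set.EqOn h' h (consts I) ∧
      Set.EqOn (h' ∘ g) g' (τ.bodyVars ∪ τ.existVars) := by
  classical
  have h1 : ∀ c ∈ consts I, ¬ ∃ y ∈ τ.existVars, g y = c := by
    rintro c hc ⟨y, hy, rfl⟩
    exact hf.2 y hy hc
  have h2 : ∃ h' : C → C, Set.EqOn h' h (consts I) ∧ ∀ y ∈ τ.existVars, h' (g y) = g' y := by
    -- Injectivity of `g` on the existential variables makes the chosen variable the right one.
    refine ⟨fun c => if H : ∃ y ∈ τ.existVars, g y = c then g' H.choose else h c,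
      fun c hc => dif_neg (h1 c hc), fun y hy => ?_⟩
    have H : ∃ z ∈ τ.existVars, g z = g y := ⟨y, hy, rfl⟩
    simp only [dif_pos H]
    rw [hf.1 H.choose_spec.1 hy H.choose_spec.2]
  obtain ⟨h', h3, h4⟩ := h2
  refine ⟨h', h3, ?_⟩
  rintro x (hx | hx)
  · rw [hg' hx]
    exact h3 (hb ⟨x, hx, rfl⟩)
  · exact h4 x hx

theorem image_map_congr {f f' : C → C} {I : Instance S C} (h : Set.EqOn f f' (consts I)) :
    Atom.map f '' I = Atom.map f' '' I :=
  Set.image_congr fun _ hF => Atom.map_congr (h.mono (terms_subset_consts hF))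

end Extension

/-! ### Saturated bags and unfoldings -/

section Derives

variable {S : Schema} {V C : Type*}

/-- `Derives Γ B F`: the fact `F` over the constants of the bag `B` can be derived from `B` by
firing full rules in `B`, and by creating a child of `B` from which `F` is returned. The child
inherits from `B` derived facts `L` guarded by its own facts. -/
inductive Derives (Γ : Set (TGD S V)) : Instance S C → Atom S C → Prop
  | base {B : Instance S C} {F : Atom S C} : F ∈ B → Derives Γ B F
  | full {B : Instance S C} {τ : TGD S V} {g : V → C} {F : Atom S C} :
      τ ∈ Γ → τ.IsFull → (∀ A ∈ τ.bodyImage g, Derives Γ B A) → F ∈ τ.headImage g →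
      Derives Γ B F
  | child {B : Instance S C} {τ : TGD S V} {g : V → C} {L : Instance S C} {F : Atom S C} :
      τ ∈ Γ → ¬ τ.IsFull → (∀ A ∈ τ.bodyImage g, Derives Γ B A) → FreshFor τ g B →
      L.Finite → (∀ G ∈ L, Derives Γ B G) →
      (∀ G ∈ L, ∃ H ∈ τ.headImage g, G.terms ⊆ H.terms) →
      Derives Γ (τ.headImage g ∪ L) F → F.terms ⊆ g '' τ.bodyVars → Derives Γ B F

variable {Γ : Set (TGD S V)} {B X : Instance S C} {F : Atom S C}

/-- A derived fact only uses constants of a trigger's guard: a full rule has no others, and a child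
returns only facts over the trigger. The image of the guard is itself derived, so induction applies
to it. -/
theorem Derives.exists_guard (hΓ : ∀ τ ∈ Γ, τ.IsGuarded) (h : Derives Γ B F) :
    ∃ G ∈ B, F.terms ⊆ G.terms := by
  induction h with
  | base h => exact ⟨_, h, subset_rfl⟩
  | @full B τ g F hτ hfull _ hF ih =>
    obtain ⟨G, hG, hb⟩ := (hΓ τ hτ).exists_guard g
    obtain ⟨H, hH, hGH⟩ := ih G hG
    refine ⟨H, hH, (terms_subset_consts hF).trans
      ((τ.consts_headImage_subset g).trans ?_)|>.trans hGH⟩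
    rw [TGD.IsFull] at hfull
    simpa [hfull] using hb
  | @child B τ g L F hτ _ _ _ _ _ _ _ hF ih _ _ =>
    obtain ⟨G, hG, hb⟩ := (hΓ τ hτ).exists_guard g
    obtain ⟨H, hH, hGH⟩ := ih G hG
    exact ⟨H, hH, hF.trans (hb.trans hGH)⟩

theorem Derives.terms_subset (hΓ : ∀ τ ∈ Γ, τ.IsGuarded) (h : Derives Γ B F) :
    F.terms ⊆ consts B := by
  obtain ⟨G, hG, hF⟩ := h.exists_guard hΓ
  exact hF.trans (terms_subset_consts hG)

theorem Set.Finite.exists_finite_subset_forall {α β : Type*} {K : Set α} (hK : K.Finite)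
    {B : Set β} {P : Set β → α → Prop}
    (h : ∀ a ∈ K, ∃ B₀ ⊆ B, B₀.Finite ∧ ∀ B₁, B₀ ⊆ B₁ → B₁ ⊆ B → P B₁ a) :
    ∃ B₀ ⊆ B, B₀.Finite ∧ ∀ B₁, B₀ ⊆ B₁ → B₁ ⊆ B → ∀ a ∈ K, P B₁ a := by
  choose! f hf hfin hP using h
  exact ⟨⋃ a ∈ K, f a, Set.iUnion₂_subset hf, hK.biUnion hfin, fun B₁ h₁ h₂ a ha =>
    hP a ha B₁ ((Set.subset_biUnion_of_mem ha).trans h₁) h₂⟩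

/-- Compactness: a derivation inspects finitely many facts of `B`. The bound `B₁ ⊆ B` is needed
because freshness of the constants of a child passes to smaller bags but not to larger ones. -/
theorem Derives.exists_finite (h : Derives Γ B F) :
    ∃ B₀ ⊆ B, B₀.Finite ∧ ∀ B₁, B₀ ⊆ B₁ → B₁ ⊆ B → Derives Γ B₁ F := by
  induction h with
  | @base B F h =>
    exact ⟨{F}, Set.singleton_subset_iff.2 h, Set.finite_singleton F,
      fun B₁ h₁ _ => .base (h₁ rfl)⟩
  | @full B τ g F hτ hfull _ hF ih =>
    obtain ⟨B₀, hB, hfin, H⟩ := (τ.finite_bodyImage g).exists_finite_subset_forall ih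
    exact ⟨B₀, hB, hfin, fun B₁ h₁ h₂ => .full hτ hfull (H B₁ h₁ h₂) hF⟩
  | @child B τ g L F hτ hfull _ hfr hL _ hLg hd hF ih₁ ih₂ _ =>
    obtain ⟨B₀, hB, hfin, H⟩ := (τ.finite_bodyImage g).exists_finite_subset_forall ih₁
    obtain ⟨B₀', hB', hfin', H'⟩ := hL.exists_finite_subset_forall ih₂
    refine ⟨B₀ ∪ B₀', Set.union_subset hB hB', hfin.union hfin', fun B₁ h₁ h₂ => ?_⟩
    rw [Set.union_subset_iff] at h₁
    exact .child hτ hfull (H B₁ h₁.1 h₂) (hfr.mono h₂) hL (H' B₁ h₁.2 h₂) hLg hd hF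

/-- The derived facts of `B` that are inherited by a child created with the facts `N`. -/
def inherited (Γ : Set (TGD S V)) (B N : Instance S C) : Instance S C :=
  {F | Derives Γ B F ∧ ∃ H ∈ N, F.terms ⊆ H.terms}

theorem consts_union_inherited (Γ : Set (TGD S V)) (B N : Instance S C) :
    consts (N ∪ inherited Γ B N) = consts N := by
  refine (consts_union _ _).trans (Set.union_eq_left.2 ?_)
  rintro c ⟨F, ⟨-, H, hH, hF⟩, hc⟩
  exact ⟨H, hH, hF hc⟩

/-- The constructor `child` asks for a finite `L`, whereas the inherited facts may be infinitely
many; compactness selects the ones that matter. -/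
theorem Derives.of_inherited {τ : TGD S V} {g : V → C} (hτ : τ ∈ Γ) (hfull : ¬ τ.IsFull)
    (hb : ∀ A ∈ τ.bodyImage g, Derives Γ B A) (hfr : FreshFor τ g B)
    (h : Derives Γ (τ.headImage g ∪ inherited Γ B (τ.headImage g)) F)
    (hF : F.terms ⊆ g '' τ.bodyVars) : Derives Γ B F := by
  obtain ⟨B₀, hB, hfin, H⟩ := h.exists_finite
  refine .child (L := B₀ ∩ inherited Γ B (τ.headImage g)) hτ hfull hb hfr
    (hfin.inter_of_left _) (fun G hG => hG.2.1) (fun G hG => hG.2.2) (H _ ?_ ?_) hF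
  · intro G hG
    rcases hB hG with h | h
    exacts [.inl h, .inr ⟨hG, h⟩]
  · exact Set.union_subset_union_right _ Set.inter_subset_right

/-- `Unfolding Γ B X`: the instance `X` is decomposed by a finite tree whose root bag consists
of the facts derived from `B`, and whose other bags are generated in the same way from the
children created by triggers in their parents. -/
inductive Unfolding (Γ : Set (TGD S V)) : Instance S C → Instance S C → Prop
  | root (B : Instance S C) : Unfolding Γ B {F | Derives Γ B F}
  | child {B X Y : Instance S C} {τ : TGD S V} {g : V → C} :
      Unfolding Γ B X → τ ∈ Γ → ¬ τ.IsFull → (∀ A ∈ τ.bodyImage g, Derives Γ B A) →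
      FreshFor τ g X →
      Unfolding Γ (τ.headImage g ∪ inherited Γ B (τ.headImage g)) Y →
      consts X ∩ consts Y ⊆ consts (τ.headImage g) → Unfolding Γ B (X ∪ Y)

theorem Unfolding.mem_of_derives (h : Unfolding Γ B X) (hF : Derives Γ B F) : F ∈ X := by
  induction h with
  | root => exact hF
  | child _ _ _ _ _ _ _ ih => exact .inl (ih hF)

theorem Unfolding.subset (h : Unfolding Γ B X) : B ⊆ X := fun _ hF => h.mem_of_derives (.base hF)

/-- The interface between a child part `Y` and the rest consists of constants of the trigger, since
the existential constants do not occur in `X`. -/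
theorem FreshFor.inter_consts_subset {τ : TGD S V} {g : V → C} {Y : Instance S C}
    (hfr : FreshFor τ g X) (hXY : consts X ∩ consts Y ⊆ consts (τ.headImage g)) :
    consts X ∩ consts Y ⊆ g '' τ.bodyVars := by
  intro c hc
  rcases τ.consts_headImage_subset g (hXY hc) with h | ⟨y, hy, rfl⟩
  exacts [h, absurd hc.1 (hfr.2 y hy)]

/-- Saturation of the root: a fact of the child part over root constants lies over the interface, so
by induction it is derivable in the child, and the child may return it. -/
theorem Unfolding.derives_of_terms_subset (h : Unfolding Γ B X) (hF : F ∈ X)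
    (hFB : F.terms ⊆ consts B) : Derives Γ B F := by
  induction h with
  | root => exact hF
  | @child B X Y τ g hX hτ hfull hb hfr _ hXY ih₁ ih₂ =>
    rcases hF with hF | hF
    · exact ih₁ hF hFB
    · have hin : F.terms ⊆ consts X ∩ consts Y :=
        Set.subset_inter (hFB.trans (consts_mono hX.subset)) (terms_subset_consts hF)
      refine .of_inherited hτ hfull hb (hfr.mono hX.subset) (ih₂ hF ?_)
        (hin.trans (hfr.inter_consts_subset hXY))
      rw [consts_union_inherited]
      exact hin.trans hXY

/-- Root constants in a fact of the child part belong to the trigger that created the child, and the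
guard of that trigger is derived in the root. -/
theorem Unfolding.exists_guard (hΓ : ∀ τ ∈ Γ, τ.IsGuarded) (h : Unfolding Γ B X) (hF : F ∈ X) :
    ∃ G ∈ B, F.terms ∩ consts B ⊆ G.terms := by
  induction h with
  | root =>
    obtain ⟨G, hG, hFG⟩ := Derives.exists_guard hΓ hF
    exact ⟨G, hG, Set.inter_subset_left.trans hFG⟩
  | @child B X Y τ g hX hτ hfull hb hfr _ hXY ih₁ ih₂ =>
    rcases hF with hF | hF
    · exact ih₁ hF
    · obtain ⟨G, hG, hg⟩ := (hΓ τ hτ).exists_guard g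
      obtain ⟨H, hH, hGH⟩ := (hb G hG).exists_guard hΓ
      refine ⟨H, hH, fun c hc => hGH (hg (hfr.inter_consts_subset hXY
        ⟨consts_mono hX.subset hc.2, terms_subset_consts hF hc.1⟩))⟩

/-- Unfoldings can be extended so that a given trigger is satisfied. -/
theorem Unfolding.exists_extension (hΓ : ∀ τ ∈ Γ, τ.IsGuarded) (h : Unfolding Γ B X)
    {τ : TGD S V} {g : V → C} (hτ : τ ∈ Γ) (hb : τ.bodyImage g ⊆ X) (hfr : FreshFor τ g X) :
    ∃ X', Unfolding Γ B X' ∧ X ⊆ X' ∧ τ.headImage g ⊆ X' ∧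
      consts X' ⊆ consts X ∪ g '' τ.existVars := by
  induction h with
  | root B =>
    by_cases hfull : τ.IsFull
    · exact ⟨_, .root B, subset_rfl, fun F hF => .full hτ hfull hb hF, Set.subset_union_left⟩
    · have hc : consts {F | Derives Γ (τ.headImage g ∪ inherited Γ B (τ.headImage g)) F} ⊆
          consts (τ.headImage g) := by
        rintro c ⟨F, hF, hc⟩
        rw [← consts_union_inherited Γ B]
        exact Derives.terms_subset hΓ hF hc
      refine ⟨_, .child (.root B) hτ hfull hb hfr (.root _) (Set.inter_subset_right.trans hc),
        Set.subset_union_left, fun F hF => .inr (.base (.inl hF)), ?_⟩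
      rw [consts_union]
      refine Set.union_subset Set.subset_union_left (hc.trans ?_)
      refine (τ.consts_headImage_subset g).trans (Set.union_subset_union_left _ ?_)
      rw [← τ.consts_bodyImage g]
      exact consts_mono hb
  | @child B X Y τ₀ g₀ hX hτ₀ hfull₀ hb₀ hfr₀ hY hXY ih₁ ih₂ =>
    have hin := hfr₀.inter_consts_subset hXY
    obtain ⟨G, hG, hg⟩ := (hΓ τ hτ).exists_guard g
    have hbG : ∀ F ∈ τ.bodyImage g, F.terms ⊆ G.terms := fun F hF =>
      (terms_subset_consts hF).trans (by rwa [τ.consts_bodyImage g])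
    rcases hb hG with hGX | hGY
    -- The guard lies in `X`: any body fact found in `Y` is over the interface, so the child returns
    -- it to the root.
    · have hbX : τ.bodyImage g ⊆ X := by
        intro F hF
        rcases hb hF with hFX | hFY
        · exact hFX
        · have hFin : F.terms ⊆ consts X ∩ consts Y := Set.subset_inter
            ((hbG F hF).trans (terms_subset_consts hGX)) (terms_subset_consts hFY)
          refine hX.mem_of_derives (.of_inherited hτ₀ hfull₀ hb₀ (hfr₀.mono hX.subset)
            (hY.derives_of_terms_subset hFY ?_) (hFin.trans hin))
          rw [consts_union_inherited]
          exact hFin.trans hXY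
      obtain ⟨X', hX', hXX', hh, hc⟩ := ih₁ hbX (hfr.mono Set.subset_union_left)
      refine ⟨X' ∪ Y, .child hX' hτ₀ hfull₀ hb₀ ⟨hfr₀.1, fun y hy hyc => ?_⟩ hY ?_,
        Set.union_subset_union_left _ hXX', hh.trans Set.subset_union_left, ?_⟩
      -- The old child must stay fresh for the larger `X'`. The constants added to `X` are fresh for
      -- `Y` too, and the existential constants of the old child occur in `Y`.
      · rcases hc hyc with h | ⟨z, hz, hzy⟩
        · exact hfr₀.2 y hy h
        · refine hfr.2 z hz (consts_mono Set.subset_union_right ?_)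
          rw [hzy]
          exact consts_mono (Set.subset_union_left.trans hY.subset)
            (TGD.mem_consts_headImage g₀ hy)
      · rintro c ⟨hc₁, hc₂⟩
        rcases hc hc₁ with h | ⟨z, hz, rfl⟩
        · exact hXY ⟨h, hc₂⟩
        · exact absurd (consts_mono Set.subset_union_right hc₂) (hfr.2 z hz)
      · rw [consts_union, consts_union, Set.union_right_comm]
        exact Set.union_subset_union_left _ hc
    -- The guard lies in `Y`: a body fact found in `X` is over root constants, hence derived in the
    -- root, and a fact of the child bag covers its constants. It was therefore inherited when the
    -- child was created.
    · have hbY : τ.bodyImage g ⊆ Y := by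
        intro F hF
        rcases hb hF with hFX | hFY
        · have hFin : F.terms ⊆ consts X ∩ consts Y := Set.subset_inter
            (terms_subset_consts hFX) ((hbG F hF).trans (terms_subset_consts hGY))
          have hFB : F.terms ⊆ consts B := by
            refine (hFin.trans hin).trans ?_
            rw [← τ₀.consts_bodyImage g₀]
            rintro c ⟨A, hA, hc⟩
            exact (hb₀ A hA).terms_subset hΓ hc
          obtain ⟨H, hH, hGH⟩ := hY.exists_guard hΓ hGY
          rw [consts_union_inherited] at hGH
          have hFH : F.terms ⊆ H.terms :=
            (Set.subset_inter (hbG F hF) (hFin.trans hXY)).trans hGH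
          refine hY.subset (.inr ⟨hX.derives_of_terms_subset hFX hFB, ?_⟩)
          rcases hH with hH | ⟨-, K, hK, hHK⟩
          exacts [⟨H, hH, hFH⟩, ⟨K, hK, hFH.trans hHK⟩]
        · exact hFY
      obtain ⟨Y', hY', hYY', hh, hc⟩ := ih₂ hbY (hfr.mono Set.subset_union_right)
      refine ⟨X ∪ Y', .child hX hτ₀ hfull₀ hb₀ hfr₀ hY' ?_,
        Set.union_subset_union_right _ hYY', hh.trans Set.subset_union_right, ?_⟩
      · rintro c ⟨hc₁, hc₂⟩
        rcases hc hc₂ with h | ⟨z, hz, rfl⟩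
        · exact hXY ⟨hc₁, h⟩
        · exact absurd (consts_mono Set.subset_union_left hc₁) (hfr.2 z hz)
      · rw [consts_union, consts_union, Set.union_assoc]
        exact Set.union_subset_union_right _ hc

end Derives

/-! ### Effect of a single step on a tree -/

namespace BagTree

variable {S : Schema} {C : Type*}

theorem inst_single (D : Instance S C) : (single D).inst = D := by
  ext F
  simp [inst, single]

/-- Propagation only copies facts. Emptiness of bags at absent addresses ensures that a newly
created node brings in nothing beyond `N`. -/
theorem inst_fire {t : BagTree S C} (ht : ∀ u ∉ t.nodes, t.bag u = ∅) (w : Node)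
    (N : Set (Atom S C)) (P : Set Node) : (t.fire w N P).inst = t.inst ∪ N := by
  apply Set.Subset.antisymm
  · rintro F ⟨u, -, (hF | ⟨-, hF⟩) | ⟨-, hF, -⟩⟩
    · refine .inl ⟨u, ?_, hF⟩
      by_contra hu
      simp [ht u hu] at hF
    · exact .inr hF
    · exact hF
  · rintro F (⟨u, hu, hF⟩ | hF)
    · exact ⟨u, .inr hu, .inl (.inl hF)⟩
    · exact ⟨w, .inl rfl, .inl (.inr ⟨rfl, hF⟩)⟩

theorem bag_fire_eq_empty {t : BagTree S C} (ht : ∀ u ∉ t.nodes, t.bag u = ∅) {w : Node}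
    {N : Set (Atom S C)} {P : Set Node} : ∀ u ∉ (t.fire w N P).nodes, (t.fire w N P).bag u = ∅ := by
  intro u hu
  simp only [fire, Set.mem_insert_iff, not_or] at hu
  have hp : t.putBag w N u = ∅ := by
    simp [putBag, ht u hu.2, hu.1]
  simp [fire, hp]

theorem bag_subset_fire (t : BagTree S C) (w : Node) (N : Set (Atom S C)) (P : Set Node)
    (u : Node) : t.bag u ⊆ (t.fire w N P).bag u := fun _ hF => .inl (.inl hF)

theorem subset_bag_fire (t : BagTree S C) (w : Node) (N : Set (Atom S C)) (P : Set Node) :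
    N ⊆ (t.fire w N P).bag w := fun _ hF => .inl (.inr ⟨rfl, hF⟩)

theorem fire_modifies_suffix {t : BagTree S C} {w v : Node} {N : Set (Atom S C)}
    (h : t.Modifies (t.fire w N {u | u <:+ w}) v) : v <:+ w := by
  obtain ⟨u, hvu, ⟨rfl | hu, hu'⟩ | hu⟩ := h
  · exact hvu
  · exact absurd hu hu'
  · refine hvu.trans ?_
    by_contra huw
    refine hu (Set.Subset.antisymm ?_ (bag_subset_fire ..))
    rintro F ((hF | ⟨rfl, -⟩) | ⟨hF, -⟩)
    exacts [hF, absurd List.suffix_rfl huw, absurd hF huw]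

end BagTree

/-! ### Realizing derivations and unfoldings by the one-pass chase -/

section OnePass

variable {S : Schema} {V C : Type*}

/-- A one-pass chase step on pairs of a tree and the node that received the last facts: the step
is triggered in that node or in one of its ancestors. -/
def OnePassStep (Γ : Set (TGD S V)) (s s' : BagTree S C × Node) : Prop :=
  ∃ p, p <:+ s.2 ∧ p ∈ s.1.nodes ∧ ∃ τ ∈ Γ, ∃ g : V → C, τ.bodyImage g ⊆ s.1.bag p ∧
    FreshFor τ g s.1.inst ∧ IsReceiver τ s.1 p s'.2 ∧
    s'.1 = s.1.fire s'.2 (τ.headImage g) {u | u <:+ s'.2}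

abbrev OnePassReach (Γ : Set (TGD S V)) : BagTree S C × Node → BagTree S C × Node → Prop :=
  Relation.ReflTransGen (OnePassStep Γ)

/-- Properties of the states of a one-pass chase sequence. -/
structure IsOnePassState (s : BagTree S C × Node) : Prop where
  mem : s.2 ∈ s.1.nodes
  mem_of_suffix : ∀ v ∈ s.1.nodes, ∀ u, u <:+ v → u ∈ s.1.nodes
  finite : s.1.nodes.Finite
  bag_eq_empty : ∀ u ∉ s.1.nodes, s.1.bag u = ∅
  infinite : (consts s.1.inst)ᶜ.Infinite
  closed : ∀ u, u <:+ s.2 → ∀ F ∈ s.1.inst, ∀ G ∈ s.1.bag u, F.terms ⊆ G.terms → F ∈ s.1.bag u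

variable {Γ : Set (TGD S V)} {s s' : BagTree S C × Node} {v : Node}

theorem isOnePassState_single {D : Instance S C} (hD : (consts D)ᶜ.Infinite) :
    IsOnePassState (BagTree.single D, ([] : Node)) where
  mem := rfl
  mem_of_suffix := by
    rintro _ rfl u hu
    exact List.suffix_nil.1 hu
  finite := Set.finite_singleton _
  bag_eq_empty := by
    intro u hu
    have : u ≠ [] := hu
    simp [BagTree.single, this]
  infinite := by
    rwa [BagTree.inst_single]
  closed := by
    intro u hu F hF _ _ _
    rw [BagTree.inst_single] at hF
    exact ⟨List.suffix_nil.1 hu, hF⟩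

theorem OnePassStep.isOnePassState (h : OnePassStep Γ s s') (hs : IsOnePassState s) :
    IsOnePassState s' := by
  obtain ⟨t, w⟩ := s
  obtain ⟨t', w'⟩ := s'
  obtain ⟨p, hpw, hp, τ, hτ, g, hb, hfr, hw', ht'⟩ := h
  dsimp only at *
  subst ht'
  have hinst := BagTree.inst_fire hs.bag_eq_empty w' (τ.headImage g) {u | u <:+ w'}
  refine ⟨.inl rfl, ?_, hs.finite.insert _, BagTree.bag_fire_eq_empty hs.bag_eq_empty, ?_, ?_⟩
  · rintro u (rfl | hu) u' hu'
    · rcases hw' with ⟨-, rfl⟩ | ⟨-, -, k, rfl⟩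
      · exact .inr (hs.mem_of_suffix _ hp _ hu')
      · rcases List.suffix_cons_iff.1 hu' with rfl | hu'
        exacts [.inl rfl, .inr (hs.mem_of_suffix _ hp _ hu')]
    · exact .inr (hs.mem_of_suffix _ hu _ hu')
  · dsimp only
    rw [hinst]
    exact infinite_compl_consts_union hs.infinite (τ.finite_headImage g)
  · intro u hu F hF G hG hFG
    dsimp only at *
    rw [hinst] at hF
    rcases hG with hG | ⟨-, -, H, hH, hGH⟩
    exacts [.inr ⟨hu, hF, G, hG, hFG⟩, .inr ⟨hu, hF, H, hH, hFG.trans hGH⟩]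

theorem OnePassStep.bag_subset (h : OnePassStep Γ s s') (u : Node) :
    s.1.bag u ⊆ s'.1.bag u := by
  obtain ⟨p, -, -, τ, -, g, -, -, -, h⟩ := h
  rw [h]
  exact BagTree.bag_subset_fire ..

theorem OnePassStep.nodes_subset (h : OnePassStep Γ s s') : s.1.nodes ⊆ s'.1.nodes := by
  obtain ⟨p, -, -, τ, -, g, -, -, -, h⟩ := h
  rw [h]
  exact Set.subset_insert _ _

theorem OnePassReach.isOnePassState (h : OnePassReach Γ s s') (hs : IsOnePassState s) :
    IsOnePassState s' := by
  induction h with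
  | refl => exact hs
  | tail _ h ih => exact h.isOnePassState ih

theorem OnePassReach.bag_subset (h : OnePassReach Γ s s') (u : Node) :
    s.1.bag u ⊆ s'.1.bag u := by
  induction h with
  | refl => rfl
  | tail _ h ih => exact ih.trans (h.bag_subset u)

theorem OnePassReach.nodes_subset (h : OnePassReach Γ s s') : s.1.nodes ⊆ s'.1.nodes := by
  induction h with
  | refl => rfl
  | tail _ h ih => exact ih.trans h.nodes_subset

theorem OnePassReach.inst_subset (h : OnePassReach Γ s s') : s.1.inst ⊆ s'.1.inst :=
  fun _ ⟨u, hu, hF⟩ => ⟨u, h.nodes_subset hu, h.bag_subset u hF⟩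

theorem IsOnePassState.exists_full (hs : IsOnePassState s) (hv : v <:+ s.2) {τ : TGD S V}
    (hτ : τ ∈ Γ) (hfull : τ.IsFull) {g : V → C} (hb : τ.bodyImage g ⊆ s.1.bag v) :
    ∃ s', OnePassStep Γ s s' ∧ v <:+ s'.2 ∧ τ.headImage g ⊆ s'.1.bag v :=
  ⟨(s.1.fire v (τ.headImage g) {u | u <:+ v}, v),
    ⟨v, hv, hs.mem_of_suffix _ hs.mem _ hv, τ, hτ, g, hb, hfull.freshFor _ _, .inl ⟨hfull, rfl⟩,
      rfl⟩, List.suffix_rfl, BagTree.subset_bag_fire ..⟩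

/-- An abstract child with existential constants given by `g` is imitated by a real one with
constants fresh for the whole tree; `σ'` records the renaming. The last clause is propagation into
the new node, the counterpart of `inherited`. -/
theorem IsOnePassState.exists_child (hs : IsOnePassState s) (hv : v <:+ s.2) {τ : TGD S V}
    (hτ : τ ∈ Γ) (hfull : ¬ τ.IsFull) {g : V → C} {I : Instance S C} (hfr : FreshFor τ g I)
    (hbI : g '' τ.bodyVars ⊆ consts I) {σ : C → C}
    (hb : Atom.map σ '' τ.bodyImage g ⊆ s.1.bag v) :
    ∃ (σ' : C → C) (s' : BagTree S C × Node), OnePassStep Γ s s' ∧ v <:+ s'.2 ∧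
      Set.EqOn σ' σ (consts I) ∧ Atom.map σ' '' τ.headImage g ⊆ s'.1.bag s'.2 ∧
      ∀ F : Atom S C, F.map σ' ∈ s.1.bag v → (∃ H ∈ τ.headImage g, F.terms ⊆ H.terms) →
        F.map σ' ∈ s'.1.bag s'.2 := by
  have hvn := hs.mem_of_suffix _ hs.mem _ hv
  obtain ⟨g', hg', hfr'⟩ := τ.exists_freshFor (σ ∘ g) hs.infinite
  obtain ⟨σ', hσ', hσg⟩ := hfr.exists_extension hbI hg'
  have hinj : Function.Injective fun k : ℕ => k :: v := fun a b h => (List.cons.inj h).1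
  obtain ⟨k, hk⟩ := (hs.finite.preimage hinj.injOn).infinite_compl.nonempty
  have hN : Atom.map σ' '' τ.headImage g = τ.headImage g' := TGD.image_headImage hσg
  have hsub := BagTree.subset_bag_fire s.1 (k :: v) (τ.headImage g') {u | u <:+ k :: v}
  refine ⟨σ', (s.1.fire (k :: v) (τ.headImage g') {u | u <:+ k :: v}, k :: v),
    ⟨v, hv, hvn, τ, hτ, g', ?_, hfr', .inr ⟨hfull, hk, k, rfl⟩, rfl⟩, List.suffix_cons _ _, hσ',
    hN.trans_subset hsub, ?_⟩
  · rw [TGD.bodyImage_congr hg', ← TGD.image_bodyImage]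
    exact hb
  · rintro F hF ⟨H, hH, hFH⟩
    refine .inr ⟨List.suffix_rfl, .inl ⟨v, hvn, hF⟩, H.map σ', .inr ⟨rfl, ?_⟩, ?_⟩
    · rw [← hN]
      exact ⟨H, hH, rfl⟩
    · rw [Atom.terms_map, Atom.terms_map]
      exact Set.image_mono hFH

/-- From every state in which the node `v` is still accessible and contains the image of `B`
under `σ`, the one-pass chase can add the image of `F` to `v`. -/
def Realizable (Γ : Set (TGD S V)) (B : Instance S C) (F : Atom S C) : Prop :=
  ∀ (σ : C → C) (v : Node) (s : BagTree S C × Node), IsOnePassState s → v <:+ s.2 →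
    Atom.map σ '' B ⊆ s.1.bag v →
    ∃ s', OnePassReach Γ s s' ∧ v <:+ s'.2 ∧ F.map σ ∈ s'.1.bag v

theorem Set.Finite.exists_onePassReach {K B : Instance S C} (hK : K.Finite)
    (h : ∀ F ∈ K, Realizable Γ B F) {σ : C → C} (hs : IsOnePassState s) (hv : v <:+ s.2)
    (hB : Atom.map σ '' B ⊆ s.1.bag v) :
    ∃ s', OnePassReach Γ s s' ∧ v <:+ s'.2 ∧ Atom.map σ '' K ⊆ s'.1.bag v := by
  induction K, hK using Set.Finite.induction_on with
  | empty => exact ⟨s, .refl, hv, by simp⟩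
  | @insert F K _ _ ih =>
    obtain ⟨s₁, hr₁, hv₁, hK₁⟩ := ih fun G hG => h G (.inr hG)
    obtain ⟨s₂, hr₂, hv₂, hF⟩ := h F (.inl rfl) σ v s₁ (hr₁.isOnePassState hs) hv₁
      (hB.trans (hr₁.bag_subset v))
    refine ⟨s₂, hr₁.trans hr₂, hv₂, ?_⟩
    rw [Set.image_insert_eq]
    exact Set.insert_subset hF (hK₁.trans (OnePassReach.bag_subset hr₂ v))

/-- Since the statement quantifies over all states with `v` on the current path, the realizations of
several facts can be run one after another, although each leaves subtrees behind. -/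
theorem Derives.realizable (hΓ : ∀ τ ∈ Γ, τ.IsGuarded) {B : Instance S C} {F : Atom S C}
    (h : Derives Γ B F) : Realizable Γ B F := by
  induction h with
  | base h => exact fun σ v s _ hv hB => ⟨s, .refl, hv, hB ⟨_, h, rfl⟩⟩
  | @full B τ g F hτ hfull _ hF ih =>
    intro σ v s hs hv hB
    obtain ⟨s₁, hr₁, hv₁, hK₁⟩ := (τ.finite_bodyImage g).exists_onePassReach ih hs hv hB
    rw [TGD.image_bodyImage] at hK₁
    obtain ⟨s₂, hr₂, hv₂, hh⟩ := (hr₁.isOnePassState hs).exists_full hv₁ hτ hfull hK₁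
    refine ⟨s₂, hr₁.tail hr₂, hv₂, hh ?_⟩
    rw [← TGD.image_headImage (fun _ _ => rfl)]
    exact ⟨F, hF, rfl⟩
  | @child B τ g L F hτ hfull hb hfr hL hLd hLg _ hF ih₁ ih₂ ih₃ =>
    intro σ v s hs hv hB
    obtain ⟨s₁, hr₁, hv₁, hK₁⟩ := ((τ.finite_bodyImage g).union hL).exists_onePassReach
      (fun G hG => hG.elim (ih₁ G) (ih₂ G)) hs hv hB
    rw [Set.image_union, Set.union_subset_iff] at hK₁
    have hbB : g '' τ.bodyVars ⊆ consts B := by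
      rw [← τ.consts_bodyImage g]
      rintro c ⟨A, hA, hc⟩
      exact (hb A hA).terms_subset hΓ hc
    obtain ⟨σ', s₂, hr₂, hv₂, hσ', hN, hI⟩ :=
      (hr₁.isOnePassState hs).exists_child hv₁ hτ hfull hfr hbB hK₁.1
    have hr₁₂ : OnePassReach Γ s s₂ := hr₁.tail hr₂
    obtain ⟨s₃, hr₃, hv₃, hF₃⟩ := ih₃ σ' s₂.2 s₂ (hr₁₂.isOnePassState hs) List.suffix_rfl (by
      rw [Set.image_union]
      refine Set.union_subset hN ?_
      rintro _ ⟨G, hG, rfl⟩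
      refine hI G ?_ (hLg G hG)
      rw [Atom.map_congr (hσ'.mono ((hLd G hG).terms_subset hΓ))]
      exact hK₁.2 ⟨G, hG, rfl⟩)
    have hr := OnePassReach.isOnePassState (hr₁₂.trans hr₃) hs
    refine ⟨s₃, hr₁₂.trans hr₃, hv₂.trans hv₃, ?_⟩
    rw [Atom.map_congr (hσ'.mono (hF.trans hbB))] at hF₃
    obtain ⟨G, hG, hg⟩ := (hΓ τ hτ).exists_guard g
    -- The result, obtained in the child, reaches `v` by propagation: `v` is an ancestor of the
    -- current node and contains the image of the guard.
    refine hr.closed v (hv₂.trans hv₃) _ ⟨_, hr.mem_of_suffix _ hr.mem _ hv₃, hF₃⟩ (G.map σ)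
      (hr₃.bag_subset v (hr₂.bag_subset v (hK₁.1 ⟨G, hG, rfl⟩))) ?_
    rw [Atom.terms_map, Atom.terms_map]
    exact Set.image_mono (hF.trans hg)

/-- Every finite part of an unfolding is mapped into some one-pass chase. -/
theorem Unfolding.exists_onePassReach (hΓ : ∀ τ ∈ Γ, τ.IsGuarded) {B X : Instance S C}
    (h : Unfolding Γ B X) {K : Instance S C} (hK : K.Finite) (hKX : K ⊆ X) :
    ∃ B₀ ⊆ B, B₀.Finite ∧ ∀ (σ : C → C) (v : Node) (s : BagTree S C × Node),
      IsOnePassState s → v <:+ s.2 → Atom.map σ '' B₀ ⊆ s.1.bag v →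
      ∃ (σ' : C → C) (s' : BagTree S C × Node), OnePassReach Γ s s' ∧ v <:+ s'.2 ∧
        Set.EqOn σ' σ (consts B) ∧ Atom.map σ' '' K ⊆ s'.1.inst := by
  induction h generalizing K with
  | root B =>
    obtain ⟨B₀, hB, hfin, H⟩ := hK.exists_finite_subset_forall
      fun F hF => Derives.exists_finite (hKX hF)
    refine ⟨B₀, hB, hfin, fun σ v s hs hv hσ => ?_⟩
    obtain ⟨s', hr, hv', hK'⟩ := hK.exists_onePassReach
      (fun F hF => (H B₀ subset_rfl hB F hF).realizable hΓ) hs hv hσ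
    have hs' := hr.isOnePassState hs
    exact ⟨σ, s', hr, hv', fun _ _ => rfl,
      fun F hF => ⟨v, hs'.mem_of_suffix _ hs'.mem _ hv', hK' hF⟩⟩
  | @child B X Y τ g hX hτ hfull hb hfr hY hXY ih₁ ih₂ =>
    have hbX : g '' τ.bodyVars ⊆ consts X := by
      rw [← τ.consts_bodyImage g]
      exact consts_mono fun A hA => hX.mem_of_derives (hb A hA)
    obtain ⟨B₁, hB₁, hfin₁, H₁⟩ := ih₁ (hK.inter_of_left X) Set.inter_subset_right
    obtain ⟨B₂, hB₂, hfin₂, H₂⟩ := ih₂ (hK.inter_of_left Y) Set.inter_subset_right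
    -- These facts must be present in `v` before the child is created: the trigger, and the
    -- inherited facts that the realization of `Y` depends on.
    have hM : (τ.bodyImage g ∪ (B₂ ∩ inherited Γ B (τ.headImage g))).Finite :=
      (τ.finite_bodyImage g).union (hfin₂.inter_of_left _)
    have hMd : ∀ F ∈ τ.bodyImage g ∪ (B₂ ∩ inherited Γ B (τ.headImage g)), Derives Γ B F :=
      fun F hF => hF.elim (hb F) fun h => h.2.1
    obtain ⟨B₃, hB₃, hfin₃, H₃⟩ := hM.exists_finite_subset_forall
      fun F hF => (hMd F hF).exists_finite
    refine ⟨B₁ ∪ B₃, Set.union_subset hB₁ hB₃, hfin₁.union hfin₃, fun σ v s hs hv hσ => ?_⟩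
    rw [Set.image_union, Set.union_subset_iff] at hσ
    obtain ⟨σ₁, s₁, hr₁, hv₁, hσ₁, hK₁⟩ := H₁ σ v s hs hv hσ.1
    have hs₁ := hr₁.isOnePassState hs
    obtain ⟨s₂, hr₂, hv₂, hK₂⟩ := hM.exists_onePassReach (σ := σ₁)
      (fun F hF => (H₃ B₃ subset_rfl hB₃ F hF).realizable hΓ) hs₁ hv₁ (by
        rw [image_map_congr (hσ₁.mono (consts_mono hB₃))]
        exact hσ.2.trans (hr₁.bag_subset v))
    have hs₂ := hr₂.isOnePassState hs₁
    rw [Set.image_union, Set.union_subset_iff] at hK₂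
    obtain ⟨σ₂, s₃, hr₃, hv₃, hσ₂, hN, hI⟩ := hs₂.exists_child hv₂ hτ hfull hfr hbX hK₂.1
    have hs₃ := hr₃.isOnePassState hs₂
    obtain ⟨σ₃, s₄, hr₄, hv₄, hσ₃, hK₄⟩ := H₂ σ₂ s₃.2 s₃ hs₃ List.suffix_rfl (by
      rintro _ ⟨F, hF, rfl⟩
      rcases hB₂ hF with hFN | hFI
      · exact hN ⟨F, hFN, rfl⟩
      · refine hI F ?_ hFI.2
        rw [Atom.map_congr (hσ₂.mono (terms_subset_consts (hX.mem_of_derives hFI.1)))]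
        exact hK₂.2 ⟨F, ⟨hF, hFI⟩, rfl⟩)
    rw [consts_union_inherited] at hσ₃
    classical
    -- The maps for `X` and `Y` can be glued: a shared constant occurs in the head image, where `σ₃`
    -- agrees with `σ₂`, and `σ₂` agrees with `σ₁` on `X`.
    have hX' : Set.EqOn (fun c => if c ∈ consts X then σ₁ c else σ₃ c) σ₁ (consts X) :=
      fun c hc => if_pos hc
    have hY' : Set.EqOn (fun c => if c ∈ consts X then σ₁ c else σ₃ c) σ₃ (consts Y) := by
      intro c hc
      by_cases hcX : c ∈ consts X
      · rw [hX' hcX, hσ₃ (hXY ⟨hcX, hc⟩), hσ₂ hcX]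
      · exact if_neg hcX
    have hr₁₄ : OnePassReach Γ s₁ s₄ := (hr₂.tail hr₃).trans hr₄
    refine ⟨_, s₄, hr₁.trans hr₁₄, hv₃.trans hv₄,
      (hX'.mono (consts_mono hX.subset)).trans hσ₁, ?_⟩
    rw [← Set.inter_eq_left.2 hKX, Set.inter_union_distrib_left, Set.image_union,
      image_map_congr (hX'.mono (consts_mono Set.inter_subset_right)),
      image_map_congr (hY'.mono (consts_mono Set.inter_subset_right))]
    exact Set.union_subset (hK₁.trans hr₁₄.inst_subset) hK₄

end OnePass

/-! ### From runs and homomorphisms to chase proofs -/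

section Sequences

variable {S : Schema} {V C : Type*} {Γ : Set (TGD S V)} {D : Instance S C}

theorem Relation.ReflTransGen.exists_seq {α : Type*} {r : α → α → Prop} {a b : α}
    (h : Relation.ReflTransGen r a b) :
    ∃ (n : ℕ) (f : ℕ → α), f 0 = a ∧ f n = b ∧ ∀ i < n, r (f i) (f (i + 1)) := by
  induction h with
  | refl => exact ⟨0, fun _ => a, rfl, rfl, fun i hi => absurd hi (Nat.not_lt_zero i)⟩
  | @tail b c _ hbc ih =>
    obtain ⟨n, f, h0, hn, hf⟩ := ih
    refine ⟨n + 1, fun i => if i ≤ n then f i else c, by simpa using h0, by simp, ?_⟩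
    intro i hi
    rcases Nat.lt_succ_iff_lt_or_eq.1 hi with hi | rfl
    · simpa [hi.le, Nat.succ_le_of_lt hi] using hf i hi
    · simpa [hn] using hbc

theorem IsReceiver.not_suffix {τ : TGD S V} {t : BagTree S C} {p w v : Node}
    (h : IsReceiver τ t p w) (hv : v ∈ t.nodes) (hvp : ¬ v <:+ p) : ¬ v <:+ w := by
  rcases h with ⟨-, rfl⟩ | ⟨-, hw, k, rfl⟩
  · exact hvp
  · intro hvw
    rcases List.suffix_cons_iff.1 hvw with rfl | h
    exacts [hw hv, hvp h]

/-- Runs of the one-pass chase on states are one-pass chase sequences. -/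
theorem OnePassReach.exists_isOnePassChaseSeq {s : BagTree S C × Node}
    (h : OnePassReach Γ (BagTree.single D, []) s) :
    ∃ (n : ℕ) (T : ℕ → BagTree S C) (p : ℕ → Node), IsOnePassChaseSeq D Γ n T p ∧ T n = s.1 := by
  obtain ⟨n, f, h0, hn, hf⟩ := Relation.ReflTransGen.exists_seq h
  have hf' := hf
  choose! p hp hpn hstep using hf'
  have hmono : ∀ i j, i ≤ j → j ≤ n → (f i).1.nodes ⊆ (f j).1.nodes := by
    intro i j hij
    induction j, hij using Nat.le_induction with
    | base => exact fun _ => subset_rfl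
    | succ j _ ih => exact fun hj => (ih (by omega)).trans (hf j (by omega)).nodes_subset
  refine ⟨n, fun i => (f i).1, p, ⟨⟨by simp [h0], fun i hi => ⟨hpn i hi, ?_⟩⟩, ?_⟩,
    by simp [hn]⟩
  · obtain ⟨τ, hτ, g, hb, hfr, hw, ht⟩ := hstep i hi
    exact ⟨τ, hτ, g, hb, hfr, _, hw, ht⟩
  intro v i j k hij hjk hk hv hvj
  -- Once the receiver has left the subtree of `v`, it never returns: the next trigger is in an
  -- ancestor of the receiver, hence also outside.
  have key : ¬ v <:+ (f (k + 1)).2 := by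
    induction k, hjk using Nat.le_induction with
    | base =>
      obtain ⟨τ, -, g, -, -, hw, -⟩ := hstep j hk
      exact hw.not_suffix (hmono i j hij hk.le hv) hvj
    | succ k hjk ih =>
      obtain ⟨τ, -, g, -, -, hw, -⟩ := hstep (k + 1) hk
      exact hw.not_suffix (hmono i (k + 1) (by omega) hk.le hv)
        fun h => ih (by omega) (h.trans (hp (k + 1) hk))
  intro hm
  dsimp only at hm
  obtain ⟨τ, -, g, -, -, -, ht⟩ := hstep k hk
  rw [ht] at hm
  exact key (BagTree.fire_modifies_suffix hm)

/-- The instances of a tree sequence form an oblivious chase sequence. -/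
theorem IsTreeSeq.isChaseSeq {targets : Node → Set Node} {n : ℕ} {T : ℕ → BagTree S C}
    {p : ℕ → Node} (h : IsTreeSeq targets D Γ n T p) :
    IsChaseSeq (ObliviousStep Γ) D n fun i => (T i).inst := by
  have hemp : ∀ i ≤ n, ∀ u ∉ (T i).nodes, (T i).bag u = ∅ := by
    intro i
    induction i with
    | zero =>
      intro _ u hu
      rw [h.1] at hu ⊢
      have : u ≠ [] := hu
      simp [BagTree.single, this]
    | succ i ih =>
      intro hi
      obtain ⟨-, τ, -, g, -, -, w, -, ht⟩ := h.2 i hi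
      rw [ht]
      exact BagTree.bag_fire_eq_empty (ih (by omega))
  refine ⟨by simp [h.1, BagTree.inst_single], fun i hi => ?_⟩
  obtain ⟨hp, τ, hτ, g, hb, hfr, w, -, ht⟩ := h.2 i hi
  refine ⟨τ, hτ, g, fun F hF => ⟨p i, hp, hb hF⟩, hfr, ?_⟩
  dsimp only
  rw [ht, BagTree.inst_fire (hemp i hi.le)]

theorem RestrictedStep.obliviousStep {I J : Instance S C} (h : RestrictedStep Γ I J) :
    ObliviousStep Γ I J := by
  obtain ⟨τ, hτ, g, ha, hf, rfl⟩ := h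
  exact ⟨τ, hτ, g, ha.1, hf, rfl⟩

/-- Oblivious chase sequences are mapped homomorphically into every class of instances that is
closed under satisfying triggers. -/
theorem IsChaseSeq.exists_hom {P : Instance S C → Prop} {J₀ : Instance S C} (h₀ : P J₀)
    (hDJ : D ⊆ J₀)
    (hP : ∀ J, P J → ∀ τ ∈ Γ, ∀ g : V → C, τ.bodyImage g ⊆ J →
      ∃ J' g', P J' ∧ J ⊆ J' ∧ Set.EqOn g' g τ.bodyVars ∧ τ.headImage g' ⊆ J')
    {n : ℕ} {I : ℕ → Instance S C} (h : IsChaseSeq (ObliviousStep Γ) D n I) :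
    D ⊆ I n ∧ (I n \ D).Finite ∧
      ∃ (J : Instance S C) (f : C → C), P J ∧ IsInstanceHom f (I n) J ∧ ∀ c ∈ consts D, f c = c := by
  obtain ⟨hI0, hstep⟩ := h
  induction n with
  | zero =>
    rw [hI0]
    exact ⟨subset_rfl, by simp, J₀, id, h₀, hDJ, fun _ _ => rfl⟩
  | succ n ih =>
    obtain ⟨hD, hfin, J, f, hJ, hf, hfD⟩ := ih fun i hi => hstep i (by omega)
    obtain ⟨τ, hτ, g, hb, hfr, hI⟩ := hstep n (by omega)
    have hb' : τ.bodyImage (f ∘ g) ⊆ J := by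
      rw [← TGD.image_bodyImage]
      rintro _ ⟨F, hF, rfl⟩
      exact hf F (hb hF)
    obtain ⟨J', g', hJ', hJJ', hg', hh⟩ := hP J hJ τ hτ _ hb'
    obtain ⟨f', hf', hfg⟩ := hfr.exists_extension
      (by rw [← τ.consts_bodyImage g]; exact consts_mono hb) hg'
    rw [hI]
    refine ⟨hD.trans Set.subset_union_left, ?_, J', f', hJ', ?_, fun c hc => ?_⟩
    · rw [Set.union_sdiff_distrib]
      exact hfin.union ((τ.finite_headImage g).subset Set.sdiff_subset)
    · rintro F (hF | hF)
      · rw [Atom.map_congr (hf'.mono (terms_subset_consts hF))]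
        exact hJJ' (hf F hF)
      · refine hh ?_
        rw [← TGD.image_headImage hfg]
        exact ⟨F, hF, rfl⟩
    · rw [hf' (consts_mono hD hc), hfD c hc]

/-- An inactive trigger is already satisfied by some extension, so the homomorphism can follow that
extension without a step; active triggers are fired. -/
theorem IsChaseSeq.exists_restricted (hD : (consts D)ᶜ.Infinite) {n : ℕ} {I : ℕ → Instance S C}
    (h : IsChaseSeq (ObliviousStep Γ) D n I) :
    ∃ (m : ℕ) (J : ℕ → Instance S C) (f : C → C), IsChaseSeq (RestrictedStep Γ) D m J ∧
      IsInstanceHom f (I n) (J m) ∧ ∀ c ∈ consts D, f c = c := by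
  obtain ⟨-, -, J, f, ⟨hJ, -⟩, hf, hfD⟩ := h.exists_hom
    (P := fun J => Relation.ReflTransGen (RestrictedStep Γ) D J ∧ (consts J)ᶜ.Infinite)
    ⟨.refl, hD⟩ subset_rfl (by
      rintro J ⟨hJ, hinf⟩ τ hτ g hb
      by_cases hact : ∃ g' : V → C, Set.EqOn g' g τ.bodyVars ∧ τ.headImage g' ⊆ J
      · obtain ⟨g', hg', hh⟩ := hact
        exact ⟨J, g', ⟨hJ, hinf⟩, subset_rfl, hg', hh⟩
      · obtain ⟨g', hg', hfr⟩ := τ.exists_freshFor g hinf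
        refine ⟨J ∪ τ.headImage g', g', ⟨hJ.tail ⟨τ, hτ, g', ⟨?_, ?_⟩, hfr, rfl⟩,
          infinite_compl_consts_union hinf (τ.finite_headImage g')⟩, Set.subset_union_left, hg',
          Set.subset_union_right⟩
        · rwa [TGD.bodyImage_congr hg']
        · rintro ⟨g'', hg'', hh⟩
          exact hact ⟨g'', hg''.trans hg', hh⟩)
  obtain ⟨m, K, h0, hm, hK⟩ := hJ.exists_seq
  exact ⟨m, K, f, ⟨h0, hK⟩, by rwa [hm], hfD⟩

theorem IsChaseSeq.exists_onePass (hD : (consts D)ᶜ.Infinite) (hΓ : ∀ τ ∈ Γ, τ.IsGuarded)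
    {n : ℕ} {I : ℕ → Instance S C} (h : IsChaseSeq (ObliviousStep Γ) D n I) :
    ∃ (m : ℕ) (T : ℕ → BagTree S C) (p : ℕ → Node) (f : C → C), IsOnePassChaseSeq D Γ m T p ∧
      IsInstanceHom f (I n) (T m).inst ∧ ∀ c ∈ consts D, f c = c := by
  have hroot : (consts {F | Derives Γ D F})ᶜ.Infinite := by
    refine hD.mono (Set.compl_subset_compl.2 ?_)
    rintro c ⟨F, hF, hc⟩
    exact Derives.terms_subset hΓ hF hc
  obtain ⟨hDI, hfin, X, f, ⟨hX, -⟩, hf, hfD⟩ := h.exists_hom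
    (P := fun X => Unfolding Γ D X ∧ (consts X)ᶜ.Infinite)
    ⟨.root D, hroot⟩ (Unfolding.root D).subset (by
      rintro X ⟨hX, hinf⟩ τ hτ g hb
      obtain ⟨g', hg', hfr⟩ := τ.exists_freshFor g hinf
      obtain ⟨X', hX', hXX', hh, hc⟩ := hX.exists_extension hΓ hτ
        ((TGD.bodyImage_congr hg').trans_subset hb) hfr
      refine ⟨X', g', ⟨hX', ?_⟩, hXX', hg', hh⟩
      refine (hinf.sdiff (τ.finite_existVars.image g')).mono ?_
      rw [Set.sdiff_eq, ← Set.compl_union]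
      exact Set.compl_subset_compl.2 hc)
  -- Only the finitely many facts outside `D` need to be realized. The possibly infinite `D` is in
  -- the root bag from the start, and `σ ∘ f` fixes its constants.
  have hK : Atom.map f '' (I n \ D) ⊆ X := by
    rintro _ ⟨F, hF, rfl⟩
    exact hf F hF.1
  obtain ⟨B₀, hB₀, -, H⟩ := hX.exists_onePassReach hΓ (hfin.image _) hK
  obtain ⟨σ, s, hr, -, hσ, hKs⟩ := H id [] _ (isOnePassState_single hD) List.suffix_rfl (by
    rintro _ ⟨F, hF, rfl⟩
    exact ⟨rfl, hB₀ hF⟩)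
  obtain ⟨m, T, p, hT, hTm⟩ := hr.exists_isOnePassChaseSeq
  have hσf : ∀ c ∈ consts D, (σ ∘ f) c = c := fun c hc => by
    rw [Function.comp_apply, hfD c hc, hσ hc, id]
  refine ⟨m, T, p, σ ∘ f, hT, fun F hF => ?_, hσf⟩
  rw [hTm]
  by_cases hFD : F ∈ D
  · rw [Atom.map_eq_self fun c hc => hσf c (terms_subset_consts hFD hc)]
    refine hr.inst_subset ?_
    dsimp only
    rwa [BagTree.inst_single]
  · exact hKs ⟨_, ⟨F, ⟨hF, hFD⟩, rfl⟩, rfl⟩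

theorem UBCQ.Holds.of_hom {Q : UBCQ S V C} (hQ : Q.Over D) {I J : Instance S C}
    (h : Q.Holds I) {f : C → C} (hf : IsInstanceHom f I J) (hfD : ∀ c ∈ consts D, f c = c) :
    Q.Holds J := by
  obtain ⟨q, hq, g, hg⟩ := h
  refine ⟨q, hq, f ∘ g, fun A hA => ?_⟩
  have key : A.map (Sum.elim (f ∘ g) id) = (A.map (Sum.elim g id)).map f := by
    rw [Atom.map_map]
    refine Atom.map_congr ?_
    rintro (x | c) hc
    · rfl
    · exact (hfD c (hQ q hq A hA c hc)).symm
  rw [key]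
  exact hf _ (hg A hA)

end Sequences

theorem mainTheorem5 {S : Schema} {V C : Type*} (D : Instance S C)
    (hD : (consts D)ᶜ.Infinite) (Γ : Set (TGD S V)) (hΓ : ∀ τ ∈ Γ, τ.IsGuarded) :
    (∀ Q : UBCQ S V C, Q.Over D →
      (HasObliviousChaseProof D Γ Q ↔ HasOnePassChaseProof D Γ Q) ∧
      (HasRestrictedChaseProof D Γ Q ↔ HasOnePassChaseProof D Γ Q)) ∧
    (∀ (n : ℕ) (T : ℕ → BagTree S C) (p : ℕ → Node), IsTreeLikeChaseSeq D Γ n T p →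
      ∃ (m : ℕ) (T' : ℕ → BagTree S C) (p' : ℕ → Node) (h : C → C),
        IsOnePassChaseSeq D Γ m T' p' ∧ IsInstanceHom h (T n).inst (T' m).inst ∧
        ∀ c ∈ consts D, h c = c) := by
  have hOne : ∀ Q : UBCQ S V C, HasOnePassChaseProof D Γ Q → HasObliviousChaseProof D Γ Q := by
    rintro Q ⟨n, T, p, hT, hQ⟩
    exact ⟨n, _, hT.1.isChaseSeq, hQ⟩
  have hObl : ∀ Q : UBCQ S V C, Q.Over D → HasObliviousChaseProof D Γ Q →
      HasOnePassChaseProof D Γ Q := by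
    rintro Q hQD ⟨n, I, hI, hQ⟩
    obtain ⟨m, T, p, f, hT, hf, hfD⟩ := hI.exists_onePass hD hΓ
    exact ⟨m, T, p, hT, hQ.of_hom hQD hf hfD⟩
  refine ⟨fun Q hQD => ⟨⟨hObl Q hQD, hOne Q⟩, ?_, fun h => ?_⟩, fun n T p hT => ?_⟩
  · rintro ⟨n, I, hI, hQ⟩
    exact hObl Q hQD ⟨n, I, ⟨hI.1, fun i hi => (hI.2 i hi).obliviousStep⟩, hQ⟩
  · obtain ⟨n, I, hI, hQ⟩ := hOne Q h
    obtain ⟨m, J, f, hJ, hf, hfD⟩ := hI.exists_restricted hD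
    exact ⟨m, J, hJ, hQ.of_hom hQD hf hfD⟩
  · obtain ⟨m, T', p', f, h⟩ := (IsTreeSeq.isChaseSeq hT).exists_onePass hD hΓ
    exact ⟨m, T', p', f, h⟩
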